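/- Let $\mathbb{D}=\{z\in\mathbb{C}:|z|<1\}$. Let $h$ be a lemniscate starlike function, that is, $h$ is analytic in $\mathbb{D}$ with $h(0)=0$, $h'(0)=1$, and $zh'(z)/h(z)\prec\sqrt{1+z}$ (principal branch), where $p\prec\psi$ means that $p=\psi\circ\omega$ on $\mathbb{D}$ for some analytic $\omega:\mathbb{D}\to\mathbb{D}$ with $\omega(0)=0$, and the value of $zh'(z)/h(z)$ at $z=0$ is its limit $1$. Let $\varphi:\mathbb{D}\to\mathbb{D}$ be analytic, and let $g$ be analytic in $\mathbb{D}$ with $g'(z)=\varphi(z)h'(z)$ for all $z\in\mathbb{D}$. Then the equation $$1-6r+12r^2-11r^3+4r^4=0$$ has exactly one root $r_0$ in $(0,1)$, it satisfies $0.3119<r_0<0.3120$, and the harmonic mapping $f=h+\overline{g}$ is univalent and close-to-convex in $|z|<r_0$. Here $f$ is called close-to-convex in $|z|<r_0$ if there it is harmonic, univalent and sense-preserving (its Jacobian is positive), and it maps this disk onto a close-to-convex domain, i.e. a domain whose complement is a union of closed half-lines such that the corresponding open half-lines are pairwise disjoint. -/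

import Mathlib

open Metric Set
open scoped ComplexConjugate

noncomputable section

/-- The class of analytic functions `h` on the open unit disk with `h 0 = 0` and `h' 0 = 1`. -/
def ClassA : Set (ℂ → ℂ) :=
  {h | DifferentiableOn ℂ h (ball 0 1) ∧ h 0 = 0 ∧ deriv h 0 = 1}

/-- The analytic functions from the open unit disk into the open unit disk. -/
def ClassBs : Set (ℂ → ℂ) :=
  {φ | DifferentiableOn ℂ φ (ball 0 1) ∧ MapsTo φ (ball 0 1) (ball 0 1)}

/-- Subordination `p ≺ ψ` on the open unit disk: `p = ψ ∘ ω` for an analytic self-map `ω` of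
the disk that fixes the origin. -/
def Subordinate (p ψ : ℂ → ℂ) : Prop :=
  ∃ ω ∈ ClassBs, ω 0 = 0 ∧ ∀ z ∈ ball (0 : ℂ) 1, p z = ψ (ω z)

/-- The function `z h'(z) / h(z)`, with its removable singularity at the origin filled in
(for `h` with `h 0 = 0` and `h' 0 = 1` its limit at the origin is `1`). -/
def starlikeQuotient (h : ℂ → ℂ) : ℂ → ℂ :=
  Function.update (fun z => z * deriv h z / h z) 0 1

/-- The Ma-Minda class of starlike functions attached to `ψ`. -/
def ClassSStar (ψ : ℂ → ℂ) : Set (ℂ → ℂ) :=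
  {h | h ∈ ClassA ∧ Subordinate (starlikeQuotient h) ψ}

/-- The lemniscate starlike functions: `ψ z = √(1 + z)`, with the principal square root. -/
def ClassSLStar : Set (ℂ → ℂ) :=
  ClassSStar fun z => (1 + z) ^ (1 / 2 : ℂ)

/-- The closed half-line from `p` in direction `d` (for `d ≠ 0`). -/
def closedHalfLine (p d : ℂ) : Set ℂ := {w | ∃ t : ℝ, 0 ≤ t ∧ w = p + t * d}

/-- The corresponding open half-line: the initial point `p` is removed. -/
def openHalfLine (p d : ℂ) : Set ℂ := {w | ∃ t : ℝ, 0 < t ∧ w = p + t * d}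

/-- A domain is close-to-convex if its complement is a union of (closed) half-lines such that the
corresponding open half-lines are pairwise disjoint. A half-line is given by its initial point
and a nonzero direction. -/
def IsCloseToConvexDomain (Ω : Set ℂ) : Prop :=
  IsOpen Ω ∧ IsConnected Ω ∧
    ∃ L : Set (ℂ × ℂ), (∀ l ∈ L, l.2 ≠ 0) ∧
      Ωᶜ = (⋃ l ∈ L, closedHalfLine l.1 l.2) ∧
      L.PairwiseDisjoint (fun l => openHalfLine l.1 l.2)

/-- `f` is univalent in `U`. -/
def IsUnivalentOn (f : ℂ → ℂ) (U : Set ℂ) : Prop := InjOn f U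

/-- `f` is sense-preserving in `U`: its (real) Jacobian is positive there. -/
def IsSensePreservingOn (f : ℂ → ℂ) (U : Set ℂ) : Prop :=
  ∀ z ∈ U, DifferentiableAt ℝ f z ∧ 0 < (fderiv ℝ f z).det

/-- `f` is a close-to-convex harmonic mapping in `U`: harmonic, univalent, sense-preserving, and
it maps `U` onto a close-to-convex domain. -/
def IsCloseToConvexOn (f : ℂ → ℂ) (U : Set ℂ) : Prop :=
  InnerProductSpace.HarmonicOnNhd f U ∧ IsUnivalentOn f U ∧ IsSensePreservingOn f U ∧
    IsCloseToConvexDomain (f '' U)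

end

/-!
Differentiating `z h' = √(1 + ω) h` logarithmically gives `h'' / h' = ω' / (2 (1 + ω)) +
(√(1 + ω) - 1) / z`, so the lemmas of Schwarz and Schwarz-Pick bound the pre-Schwarzian of a
lemniscate starlike `h` by `1.3` on `|z| ≤ 0.312`, a disk slightly larger than `|z| < r₀`. There
`h'` varies so little that, for `r ≤ 0.312` and `|a| = r`, the line through `h a` orthogonal to
`a * h' a` strictly supports the image of `|z| < r`. Hence `h` is univalent with convex image `Ω`.

In the coordinate `w = h z` the harmonic mapping is `w + E w` with `E = conj ∘ g ∘ h⁻¹`. The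
derivative of `g ∘ h⁻¹` is `φ ∘ h⁻¹`, of modulus at most some `k < 1`, so `E` is a contraction on
the convex set `Ω`. Composing `E` with the nearest-point projection `P` onto the closure of `Ω`
yields a homeomorphism `w ↦ w + E (P w)` of the plane. As `P` is constant along each outward
normal ray of `Ω`, the homeomorphism merely translates these rays, which cover the complement of
`Ω` and have pairwise disjoint interiors.
-/

open scoped InnerProductSpace Topology NNReal

section NearestPoint

variable {E : Type*} [NormedAddCommGroup E] [InnerProductSpace ℝ E]

/-- `p` is the point of `K` nearest to `x`, encoded by the variational inequality that
characterizes it when `K` is convex. -/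
def IsNearestPoint (K : Set E) (x p : E) : Prop :=
  p ∈ K ∧ ∀ y ∈ K, ⟪x - p, y - p⟫_ℝ ≤ 0

/-- The pairs `(w, n)` of a point `w ∈ K` and a unit vector `n` such that `n` is an outward normal
of `K` at `w`, that is, `K` lies in the half-space `⟪n, y - w⟫ ≤ 0`. -/
def unitNormals (K : Set E) : Set (E × E) :=
  {l | l.1 ∈ K ∧ ‖l.2‖ = 1 ∧ ∀ y ∈ K, ⟪l.2, y - l.1⟫_ℝ ≤ 0}

variable {K Ω : Set E} {x y p q w n : E}

theorem isNearestPoint_self (hx : x ∈ K) : IsNearestPoint K x x :=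
  ⟨hx, fun y _ => by rw [sub_self, inner_zero_left]⟩

theorem isNearestPoint_add_smul (hl : (w, n) ∈ unitNormals K) {t : ℝ} (ht : 0 ≤ t) :
    IsNearestPoint K (w + t • n) w := by
  refine ⟨hl.1, fun y hy => ?_⟩
  rw [add_sub_cancel_left, real_inner_smul_left]
  exact mul_nonpos_of_nonneg_of_nonpos ht (hl.2.2 y hy)

theorem exists_isNearestPoint [CompleteSpace E] (hne : K.Nonempty) (hcl : IsClosed K)
    (hK : Convex ℝ K) (x : E) : ∃ p, IsNearestPoint K x p := by
  obtain ⟨p, hp, hmin⟩ := exists_norm_eq_iInf_of_complete_convex hne hcl.isComplete hK x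
  exact ⟨p, hp, (norm_eq_iInf_iff_real_inner_le_zero hK hp).1 hmin⟩

namespace IsNearestPoint

theorem norm_sub_le (hp : IsNearestPoint K x p) (hq : IsNearestPoint K y q) :
    ‖p - q‖ ≤ ‖x - y‖ := by
  have hexpand : ⟪x - y, p - q⟫_ℝ = ‖p - q‖ ^ 2 - ⟪x - p, q - p⟫_ℝ - ⟪y - q, p - q⟫_ℝ := by
    rw [← real_inner_self_eq_norm_sq, ← neg_sub p q, inner_neg_right, sub_neg_eq_add,
      ← inner_add_left, ← inner_sub_left]
    congr 1
    abel
  have hsq : ‖p - q‖ ^ 2 ≤ ‖x - y‖ * ‖p - q‖ := by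
    linarith [hp.2 q hq.1, hq.2 p hp.1, real_inner_le_norm (x - y) (p - q)]
  rcases (norm_nonneg (p - q)).eq_or_lt with h0 | hpos
  · exact h0 ▸ norm_nonneg _
  · exact le_of_mul_le_mul_right (by rwa [sq] at hsq) hpos

theorem eq (hp : IsNearestPoint K x p) (hq : IsNearestPoint K x q) : p = q := by
  simpa [sub_eq_zero] using hp.norm_sub_le hq

end IsNearestPoint

theorem add_smul_notMem_of_mem_unitNormals (hΩ : IsOpen Ω) (hl : (w, n) ∈ unitNormals (closure Ω))
    {t : ℝ} (ht : 0 ≤ t) : w + t • n ∉ Ω := by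
  intro hmem
  have hcont : ContinuousAt (fun s : ℝ => w + s • n) t := by fun_prop
  obtain ⟨ε, hε, hball⟩ := Metric.mem_nhds_iff.1 (hcont.preimage_mem_nhds (hΩ.mem_nhds hmem))
  have hle := hl.2.2 _ (subset_closure (hball (show t + ε / 2 ∈ ball t ε by
    simpa [abs_of_pos hε] using hε)))
  rw [add_sub_cancel_left, real_inner_smul_right, real_inner_self_eq_norm_sq, hl.2.1] at hle
  linarith

variable [CompleteSpace E]

theorem exists_mem_unitNormals_of_notMem (hΩ : IsOpen Ω) (hconv : Convex ℝ Ω)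
    (hne : Ω.Nonempty) (hx : x ∈ closure Ω) (hxΩ : x ∉ Ω) :
    ∃ n, (x, n) ∈ unitNormals (closure Ω) := by
  obtain ⟨f, hf⟩ := geometric_hahn_banach_open_point hconv hΩ hxΩ
  obtain ⟨v, rfl⟩ := (InnerProductSpace.toDual ℝ E).surjective f
  simp only [InnerProductSpace.toDual_apply_apply] at hf
  have hv : v ≠ 0 := by
    rintro rfl
    obtain ⟨y, hy⟩ := hne
    simpa using hf y hy
  refine ⟨‖v‖⁻¹ • v, hx, norm_smul_inv_norm hv, fun y hy => ?_⟩
  have hle : ⟪v, y⟫_ℝ ≤ ⟪v, x⟫_ℝ :=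
    closure_minimal (t := {z | ⟪v, z⟫_ℝ ≤ ⟪v, x⟫_ℝ}) (fun z hz => (hf z hz).le)
      (isClosed_le (by fun_prop) continuous_const) hy
  rw [real_inner_smul_left, inner_sub_right]
  exact mul_nonpos_of_nonneg_of_nonpos (by positivity) (sub_nonpos.2 hle)

theorem exists_mem_unitNormals_add_smul_eq (hΩ : IsOpen Ω) (hconv : Convex ℝ Ω)
    (hne : Ω.Nonempty) (hxΩ : x ∉ Ω) :
    ∃ l ∈ unitNormals (closure Ω), ∃ t : ℝ, 0 ≤ t ∧ x = l.1 + t • l.2 := by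
  by_cases hx : x ∈ closure Ω
  · obtain ⟨n, hn⟩ := exists_mem_unitNormals_of_notMem hΩ hconv hne hx hxΩ
    exact ⟨(x, n), hn, 0, le_rfl, by simp⟩
  · obtain ⟨p, hp⟩ := exists_isNearestPoint hne.closure isClosed_closure hconv.closure x
    have hxp : x - p ≠ 0 := sub_ne_zero.2 fun h => hx (h ▸ hp.1)
    refine ⟨(p, ‖x - p‖⁻¹ • (x - p)), ⟨hp.1, norm_smul_inv_norm hxp, fun y hy => ?_⟩,
      ‖x - p‖, norm_nonneg _, ?_⟩
    · rw [real_inner_smul_left]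
      exact mul_nonpos_of_nonneg_of_nonpos (by positivity) (hp.2 y hy)
    · rw [smul_inv_smul₀ (norm_ne_zero_iff.2 hxp), add_sub_cancel]

end NearestPoint

section HalfLines

variable {K Ω : Set ℂ}

theorem compl_eq_biUnion_closedHalfLine (hΩ : IsOpen Ω) (hconv : Convex ℝ Ω) (hne : Ω.Nonempty) :
    Ωᶜ = ⋃ l ∈ unitNormals (closure Ω), closedHalfLine l.1 l.2 := by
  refine Subset.antisymm (fun x hx => ?_) (iUnion₂_subset ?_)
  · obtain ⟨l, hl, t, ht, rfl⟩ := exists_mem_unitNormals_add_smul_eq hΩ hconv hne hx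
    exact mem_biUnion hl ⟨t, ht, by rw [Complex.real_smul]⟩
  · rintro l hl _ ⟨t, ht, rfl⟩
    exact add_smul_notMem_of_mem_unitNormals hΩ hl ht

theorem pairwiseDisjoint_openHalfLine_unitNormals :
    (unitNormals K).PairwiseDisjoint fun l => openHalfLine l.1 l.2 := by
  rintro ⟨w, n⟩ hl ⟨w', n'⟩ hl' hne
  refine disjoint_left.2 ?_
  rintro _ ⟨t, ht, rfl⟩ ⟨s, hs, hts⟩
  simp only [← Complex.real_smul] at hts
  have hw : w = w' :=
    (isNearestPoint_add_smul hl ht.le).eq (hts ▸ isNearestPoint_add_smul hl' hs.le)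
  subst hw
  have hsmul : t • n = s • n' := add_left_cancel hts
  have hts' : t = s := by
    simpa [norm_smul, hl.2.1, hl'.2.1, abs_of_pos, ht, hs] using congrArg norm hsmul
  subst hts'
  exact hne (Prod.ext rfl (smul_right_injective ℂ ht.ne' hsmul))

theorem isCloseToConvexDomain_image_homeomorph (hΩ : IsOpen Ω) (hconv : Convex ℝ Ω)
    (hne : Ω.Nonempty) (T : ℂ ≃ₜ ℂ)
    (hT : ∀ l ∈ unitNormals (closure Ω), ∀ t : ℝ, 0 ≤ t → T (l.1 + t * l.2) = T l.1 + t * l.2) :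
    IsCloseToConvexDomain (T '' Ω) := by
  have hclosed : ∀ l ∈ unitNormals (closure Ω),
      T '' closedHalfLine l.1 l.2 = closedHalfLine (T l.1) l.2 := by
    intro l hl
    ext z
    constructor
    · rintro ⟨_, ⟨t, ht, rfl⟩, rfl⟩
      exact ⟨t, ht, hT l hl t ht⟩
    · rintro ⟨t, ht, rfl⟩
      exact ⟨_, ⟨t, ht, rfl⟩, hT l hl t ht⟩
  have hopen : ∀ l ∈ unitNormals (closure Ω),
      openHalfLine (T l.1) l.2 ⊆ T '' openHalfLine l.1 l.2 := by
    rintro l hl _ ⟨t, ht, rfl⟩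
    exact ⟨_, ⟨t, ht, rfl⟩, hT l hl t ht.le⟩
  refine ⟨T.isOpenMap _ hΩ, ⟨hne.image T, hconv.isPreconnected.image T T.continuous.continuousOn⟩,
    (fun l => (T l.1, l.2)) '' unitNormals (closure Ω), ?_, ?_, ?_⟩
  · rintro _ ⟨l, hl, rfl⟩
    exact norm_ne_zero_iff.1 (hl.2.1 ▸ one_ne_zero)
  · rw [← image_compl_eq T.bijective, compl_eq_biUnion_closedHalfLine hΩ hconv hne, image_iUnion₂,
      biUnion_image]
    exact iUnion₂_congr hclosed
  · rintro _ ⟨l, hl, rfl⟩ _ ⟨l', hl', rfl⟩ hll'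
    refine ((disjoint_image_iff T.injective).2 ?_).mono (hopen l hl) (hopen l' hl')
    exact pairwiseDisjoint_openHalfLine_unitNormals hl hl' fun h => hll' (h ▸ rfl)

end HalfLines

section IdentityPlusContraction

variable {X : Type*} [NormedAddCommGroup X] {f : X → X} {s : Set X} {k : ℝ≥0}

theorem injOn_id_add_of_lipschitzOnWith (hf : LipschitzOnWith k f s) (hk : k < 1) :
    InjOn (fun x => x + f x) s := by
  intro x hx y hy hxy
  have hdist : ‖x - y‖ = ‖f x - f y‖ := by
    rw [norm_sub_rev (f x), sub_eq_sub_iff_add_eq_add.2 (hxy.trans (add_comm y (f y)))]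
  have hle := hf.norm_sub_le hx hy
  have hk' : (k : ℝ) < 1 := hk
  have : ‖x - y‖ = 0 := by nlinarith [norm_nonneg (x - y), hk']
  exact sub_eq_zero.1 (norm_eq_zero.1 this)

theorem exists_homeomorph_id_add [NormedSpace ℝ X] [CompleteSpace X] (hf : LipschitzWith k f)
    (hk : k < 1) : ∃ T : X ≃ₜ X, ∀ x, T x = x + f x := by
  have happrox : ApproximatesLinearOn (fun x => x + f x)
      (ContinuousLinearEquiv.refl ℝ X : X →L[ℝ] X) univ k := by
    intro x _ y _
    simpa [add_sub_add_comm] using hf.norm_sub_le x y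
  refine ⟨happrox.toHomeomorph _ ?_, fun x => rfl⟩
  rcases subsingleton_or_nontrivial X with hX | hX
  · exact Or.inl hX
  · exact Or.inr (by simpa using hk)

theorem exists_lipschitzOnWith_closure_eqOn [CompleteSpace X] (hf : LipschitzOnWith k f s) :
    ∃ g, LipschitzOnWith k g (closure s) ∧ EqOn g f s := by
  have heq : EqOn (extendFrom s f) f s := extendFrom_extends hf.continuousOn
  have hcont : ContinuousOn (extendFrom s f) (closure s) :=
    continuousOn_extendFrom Subset.rfl fun x hx =>
      CompleteSpace.complete <|
        (cauchy_nhds.mono' (mem_closure_iff_nhdsWithin_neBot.1 hx) nhdsWithin_le_nhds).map_of_le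
          hf.uniformContinuousOn (Filter.le_principal_iff.2 self_mem_nhdsWithin)
  have hlip : LipschitzOnWith k (extendFrom s f) s := fun x hx y hy => by
    rw [heq hx, heq hy]
    exact hf hx hy
  exact ⟨_, hlip.closure hcont, heq⟩

end IdentityPlusContraction

theorem isCloseToConvexDomain_image_id_add {Ω : Set ℂ} {f : ℂ → ℂ} {k : ℝ≥0} (hΩ : IsOpen Ω)
    (hconv : Convex ℝ Ω) (hne : Ω.Nonempty) (hf : LipschitzOnWith k f Ω) (hk : k < 1) :
    IsCloseToConvexDomain ((fun w => w + f w) '' Ω) := by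
  obtain ⟨g, hg, hgf⟩ := exists_lipschitzOnWith_closure_eqOn hf
  choose P hP using exists_isNearestPoint hne.closure isClosed_closure hconv.closure
  have hgP : LipschitzWith k (g ∘ P) := LipschitzWith.of_dist_le_mul fun x y =>
    (hg.dist_le_mul _ (hP x).1 _ (hP y).1).trans <| by
      rw [dist_eq_norm, dist_eq_norm]
      gcongr
      exact (hP x).norm_sub_le (hP y)
  obtain ⟨T, hT⟩ := exists_homeomorph_id_add hgP hk
  have hTΩ : T '' Ω = (fun w => w + f w) '' Ω := image_congr fun w hw => by
    have hPw : P w = w := (hP w).eq (isNearestPoint_self (subset_closure hw))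
    rw [hT, Function.comp_apply, hPw, hgf hw]
  rw [← hTΩ]
  refine isCloseToConvexDomain_image_homeomorph hΩ hconv hne T fun l hl t ht => ?_
  have hPt : P (l.1 + t * l.2) = l.1 := (hP _).eq (isNearestPoint_add_smul hl ht)
  have hPl : P l.1 = l.1 := (hP _).eq (isNearestPoint_self hl.1)
  simp only [hT, Function.comp_apply, hPt, hPl]
  ring

section HarmonicMapping

variable {U : Set ℂ} {h g : ℂ → ℂ} {k : ℝ≥0}

theorem isOpen_image_of_deriv_ne_zero (hU : IsOpen U) (hh : DifferentiableOn ℂ h U)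
    (hh' : ∀ z ∈ U, deriv h z ≠ 0) : IsOpen (h '' U) := by
  rw [isOpen_iff_mem_nhds]
  rintro _ ⟨z, hz, rfl⟩
  have hstrict := (hh.analyticAt (hU.mem_nhds hz)).hasStrictDerivAt
  rw [← hstrict.map_nhds_eq (hh' z hz)]
  exact Filter.image_mem_map (hU.mem_nhds hz)

theorem hasDerivAt_comp_invFunOn (hU : IsOpen U) (hh : DifferentiableOn ℂ h U) (hinj : InjOn h U)
    (hg : DifferentiableOn ℂ g U) {z : ℂ} (hz : z ∈ U) (hz' : deriv h z ≠ 0) :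
    HasDerivAt (g ∘ Function.invFunOn h U) (deriv g z / deriv h z) (h z) := by
  have hleft : ∀ w ∈ U, Function.invFunOn h U (h w) = w := fun w hw => hinj.leftInvOn_invFunOn hw
  have hinv := ((hh.analyticAt (hU.mem_nhds hz)).hasStrictDerivAt.to_local_left_inverse hz'
    (Filter.eventually_of_mem (hU.mem_nhds hz) hleft)).hasDerivAt
  have hgz : HasDerivAt g (deriv g z) (Function.invFunOn h U (h z)) := by
    rw [hleft z hz]
    exact (hg.differentiableAt (hU.mem_nhds hz)).hasDerivAt
  exact hgz.comp (h z) hinv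

theorem lipschitzOnWith_comp_invFunOn (hU : IsOpen U) (hh : DifferentiableOn ℂ h U)
    (hinj : InjOn h U) (hh' : ∀ z ∈ U, deriv h z ≠ 0) (hconv : Convex ℝ (h '' U))
    (hg : DifferentiableOn ℂ g U) (hgh : ∀ z ∈ U, ‖deriv g z‖ ≤ k * ‖deriv h z‖) :
    LipschitzOnWith k (g ∘ Function.invFunOn h U) (h '' U) := by
  refine hconv.lipschitzOnWith_of_nnnorm_deriv_le ?_ ?_ <;> rintro _ ⟨z, hz, rfl⟩ <;>
    have hderiv := hasDerivAt_comp_invFunOn hU hh hinj hg hz (hh' z hz)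
  · exact hderiv.differentiableAt
  · rw [hderiv.deriv, ← NNReal.coe_le_coe, coe_nnnorm, norm_div]
    exact div_le_of_le_mul₀ (norm_nonneg _) k.2 (hgh z hz)

theorem hasFDerivAt_add_conj {a b z : ℂ} (hh : HasDerivAt h a z) (hg : HasDerivAt g b z) :
    HasFDerivAt (fun z => h z + conj (g z))
      (a • (1 : ℂ →L[ℝ] ℂ) + (Complex.conjCLE : ℂ →L[ℝ] ℂ).comp (b • (1 : ℂ →L[ℝ] ℂ))) z :=
  hh.complexToReal_fderiv.add
    ((Complex.conjCLE : ℂ →L[ℝ] ℂ).hasFDerivAt.comp z hg.complexToReal_fderiv)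

theorem det_smul_add_conj (a b : ℂ) :
    (a • (1 : ℂ →L[ℝ] ℂ) + (Complex.conjCLE : ℂ →L[ℝ] ℂ).comp (b • (1 : ℂ →L[ℝ] ℂ))).det =
      ‖a‖ ^ 2 - ‖b‖ ^ 2 := by
  have hmatrix : LinearMap.toMatrix Complex.basisOneI Complex.basisOneI
      (a • (1 : ℂ →L[ℝ] ℂ) + (Complex.conjCLE : ℂ →L[ℝ] ℂ).comp (b • (1 : ℂ →L[ℝ] ℂ)) : ℂ →L[ℝ] ℂ) =
      !![a.re + b.re, -a.im - b.im; a.im - b.im, a.re - b.re] := by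
    ext i j
    fin_cases i <;> fin_cases j <;> simp [LinearMap.toMatrix_apply, sub_eq_add_neg]
  rw [ContinuousLinearMap.det, ← LinearMap.det_toMatrix Complex.basisOneI, hmatrix,
    Matrix.det_fin_two_of, Complex.sq_norm, Complex.sq_norm, Complex.normSq_apply,
    Complex.normSq_apply]
  ring

theorem isSensePreservingOn_add_conj (hU : IsOpen U) (hh : DifferentiableOn ℂ h U)
    (hg : DifferentiableOn ℂ g U) (hgh : ∀ z ∈ U, ‖deriv g z‖ < ‖deriv h z‖) :
    IsSensePreservingOn (fun z => h z + conj (g z)) U := by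
  intro z hz
  have hderiv := hasFDerivAt_add_conj (hh.differentiableAt (hU.mem_nhds hz)).hasDerivAt
    (hg.differentiableAt (hU.mem_nhds hz)).hasDerivAt
  refine ⟨hderiv.differentiableAt, ?_⟩
  rw [hderiv.fderiv, det_smul_add_conj, sub_pos]
  exact pow_lt_pow_left₀ (hgh z hz) (norm_nonneg _) two_ne_zero

theorem harmonicOnNhd_add_conj (hU : IsOpen U) (hh : DifferentiableOn ℂ h U)
    (hg : DifferentiableOn ℂ g U) :
    InnerProductSpace.HarmonicOnNhd (fun z => h z + conj (g z)) U := fun _ hz =>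
  (hh.analyticAt (hU.mem_nhds hz)).harmonicAt.add
    (hg.analyticAt (hU.mem_nhds hz)).harmonicAt_conj

theorem isCloseToConvexOn_add_conj (hU : IsOpen U) (hne : U.Nonempty)
    (hh : DifferentiableOn ℂ h U) (hinj : InjOn h U) (hh' : ∀ z ∈ U, deriv h z ≠ 0)
    (hconv : Convex ℝ (h '' U)) (hg : DifferentiableOn ℂ g U) (hk : k < 1)
    (hgh : ∀ z ∈ U, ‖deriv g z‖ ≤ k * ‖deriv h z‖) :
    IsCloseToConvexOn (fun z => h z + conj (g z)) U := by
  let f : ℂ → ℂ := fun w => conj ((g ∘ Function.invFunOn h U) w)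
  have hf : LipschitzOnWith k f (h '' U) := fun x hx y hy => by
    rw [Complex.isometry_conj.edist_eq]
    exact lipschitzOnWith_comp_invFunOn hU hh hinj hh' hconv hg hgh hx hy
  have hfactor : EqOn ((fun w => w + f w) ∘ h) (fun z => h z + conj (g z)) U := fun z hz => by
    simp only [f, Function.comp_apply, hinj.leftInvOn_invFunOn hz]
  refine ⟨harmonicOnNhd_add_conj hU hh hg, ?_,
    isSensePreservingOn_add_conj hU hh hg fun z hz => ?_, ?_⟩
  · exact ((injOn_id_add_of_lipschitzOnWith hf hk).comp hinj (mapsTo_image h U)).congr hfactor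
  · exact (hgh z hz).trans_lt (mul_lt_of_lt_one_left (norm_pos_iff.2 (hh' z hz)) hk)
  · rw [← image_congr hfactor, image_comp]
    exact isCloseToConvexDomain_image_id_add (isOpen_image_of_deriv_ne_zero hU hh hh') hconv
      (hne.image h) hf hk

end HarmonicMapping

section MeanValue

variable {G : Type*} [NormedAddCommGroup G] [NormedSpace ℂ G] {f : ℂ → G} {s : Set ℂ} {a b : ℂ}

theorem hasDerivAt_comp_lineMap {t : ℝ} (hf : DifferentiableAt ℂ f (AffineMap.lineMap a b t)) :
    HasDerivAt (fun t : ℝ => f (AffineMap.lineMap a b t))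
      ((b - a) • deriv f (AffineMap.lineMap a b t)) t :=
  hf.hasDerivAt.scomp t AffineMap.hasDerivAt_lineMap

theorem norm_le_mul_exp_of_norm_deriv_le {M : ℝ} (hs : Convex ℝ s)
    (hd : ∀ z ∈ s, DifferentiableAt ℂ f z) (hM : ∀ z ∈ s, ‖deriv f z‖ ≤ M * ‖f z‖)
    (ha : a ∈ s) (hb : b ∈ s) : ‖f b‖ ≤ ‖f a‖ * Real.exp (M * ‖b - a‖) := by
  have hmem : ∀ t ∈ Icc (0 : ℝ) 1, AffineMap.lineMap a b t ∈ s := fun t ht =>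
    hs.lineMap_mem ha hb ht
  have hder := fun t ht => hasDerivAt_comp_lineMap (hd _ (hmem t ht))
  have hbound : ∀ t ∈ Ico (0 : ℝ) 1, ‖(b - a) • deriv f (AffineMap.lineMap a b t)‖ ≤
      M * ‖b - a‖ * ‖f (AffineMap.lineMap a b t)‖ + 0 := fun t ht => by
    rw [norm_smul, add_zero, mul_right_comm, mul_comm]
    gcongr
    exact hM _ (hmem t (Ico_subset_Icc_self ht))
  have hgronwall := norm_le_gronwallBound_of_norm_deriv_right_le (δ := ‖f a‖)
    (fun t ht => (hder t ht).continuousAt.continuousWithinAt)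
    (fun t ht => (hder t (Ico_subset_Icc_self ht)).hasDerivWithinAt) (by simp) hbound 1 (by simp)
  simpa [gronwallBound_ε0] using hgronwall

theorem norm_sub_sub_le_of_norm_deriv_sub_le {L : ℝ} (hs : Convex ℝ s)
    (hd : ∀ z ∈ s, DifferentiableAt ℂ f z) (ha : a ∈ s) (hb : b ∈ s)
    (hL : ∀ z ∈ s, ‖deriv f z - deriv f a‖ ≤ L * ‖z - a‖) :
    ‖f b - f a - (b - a) • deriv f a‖ ≤ L / 2 * ‖b - a‖ ^ 2 := by
  have hmem : ∀ t ∈ Icc (0 : ℝ) 1, AffineMap.lineMap a b t ∈ s := fun t ht =>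
    hs.lineMap_mem ha hb ht
  have hder : ∀ t ∈ Icc (0 : ℝ) 1,
      HasDerivAt (fun t : ℝ => f (AffineMap.lineMap a b t) - f a - t • (b - a) • deriv f a)
      ((b - a) • deriv f (AffineMap.lineMap a b t) - (b - a) • deriv f a) t := fun t ht => by
    have hlin := (hasDerivAt_id t).smul_const ((b - a) • deriv f a)
    rw [one_smul] at hlin
    exact ((hasDerivAt_comp_lineMap (hd _ (hmem t ht))).sub_const (f a)).fun_sub hlin
  have hbound : ∀ t ∈ Ico (0 : ℝ) 1,
      ‖(b - a) • deriv f (AffineMap.lineMap a b t) - (b - a) • deriv f a‖ ≤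
        L * ‖b - a‖ ^ 2 * t := fun t ht => by
    have hLt := hL _ (hmem t (Ico_subset_Icc_self ht))
    rw [← dist_eq_norm, ← dist_eq_norm, dist_lineMap_left, Real.norm_of_nonneg ht.1,
      dist_eq_norm, dist_eq_norm, norm_sub_rev a b] at hLt
    rw [← smul_sub, norm_smul]
    nlinarith [norm_nonneg (b - a)]
  have htaylor := image_norm_le_of_norm_deriv_right_le_deriv_boundary (a := 0) (b := 1)
    (B := fun t => L * ‖b - a‖ ^ 2 * (t ^ 2 / 2)) (B' := fun t => L * ‖b - a‖ ^ 2 * t)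
    (fun t ht => (hder t ht).continuousAt.continuousWithinAt)
    (fun t ht => (hder t (Ico_subset_Icc_self ht)).hasDerivWithinAt) (by simp)
    (fun t => by simpa using ((hasDerivAt_pow 2 t).div_const 2).const_mul (L * ‖b - a‖ ^ 2))
    hbound (x := 1) (by simp)
  simp only [AffineMap.lineMap_apply_one, one_smul, one_pow] at htaylor
  linarith

end MeanValue

theorem convex_of_forall_mem_frontier_exists_lt {E : Type*} [AddCommGroup E] [Module ℝ E]
    [TopologicalSpace E] [ContinuousAdd E] [ContinuousSMul ℝ E] {Ω : Set E} (hΩ : IsOpen Ω)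
    (hsupp : ∀ p ∈ frontier Ω, ∃ l : E →ₗ[ℝ] ℝ, ∀ y ∈ Ω, l y < l p) : Convex ℝ Ω := by
  rw [convex_iff_segment_subset]
  intro x hx y hy
  refine (convex_segment x y).isPreconnected.subset_of_closure_inter_subset hΩ
    ⟨x, left_mem_segment ℝ x y, hx⟩ ?_
  rintro p ⟨hp, hpxy⟩
  by_contra hpΩ
  obtain ⟨l, hl⟩ := hsupp p (hΩ.frontier_eq ▸ ⟨hp, hpΩ⟩)
  have hlt : l p < l p :=
    (convex_halfSpace_lt l.isLinear (l p)).segment_subset (hl x hx) (hl y hy) hpxy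
  exact hlt.false

section ConvexImage

variable {h : ℂ → ℂ} {c a z : ℂ} {r M : ℝ}

theorem norm_deriv_le_of_norm_deriv_deriv_le (hh : AnalyticOnNhd ℂ h (closedBall c r))
    (hM : 0 ≤ M) (hMh : ∀ z ∈ closedBall c r, ‖deriv (deriv h) z‖ ≤ M * ‖deriv h z‖)
    (ha : a ∈ closedBall c r) (hz : z ∈ closedBall c r) :
    ‖deriv h z‖ ≤ ‖deriv h a‖ * Real.exp (2 * (M * r)) := by
  refine (norm_le_mul_exp_of_norm_deriv_le (convex_closedBall c r)
    (fun w hw => (hh w hw).deriv.differentiableAt) hMh ha hz).trans ?_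
  have hdist : ‖z - a‖ ≤ 2 * r := by
    rw [← dist_eq_norm, two_mul]
    exact (dist_triangle_right z a c).trans (add_le_add hz ha)
  rw [mul_left_comm]
  gcongr

theorem deriv_ne_zero_of_norm_deriv_deriv_le (hh : AnalyticOnNhd ℂ h (closedBall c r))
    (hM : 0 ≤ M) (hMh : ∀ z ∈ closedBall c r, ‖deriv (deriv h) z‖ ≤ M * ‖deriv h z‖)
    (hc : deriv h c ≠ 0) (hz : z ∈ closedBall c r) : deriv h z ≠ 0 := by
  intro hz0
  have hc' := norm_deriv_le_of_norm_deriv_deriv_le hh hM hMh hz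
    (mem_closedBall_self (nonempty_closedBall.1 ⟨z, hz⟩))
  rw [hz0, norm_zero, zero_mul] at hc'
  exact hc (norm_le_zero_iff.1 hc')

theorem norm_sub_sub_mul_deriv_le (hh : AnalyticOnNhd ℂ h (closedBall c r))
    (hM : 0 ≤ M) (hMh : ∀ z ∈ closedBall c r, ‖deriv (deriv h) z‖ ≤ M * ‖deriv h z‖)
    (ha : a ∈ closedBall c r) (hz : z ∈ closedBall c r) :
    ‖h z - h a - (z - a) * deriv h a‖ ≤
      M * (‖deriv h a‖ * Real.exp (2 * (M * r))) / 2 * ‖z - a‖ ^ 2 := by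
  refine norm_sub_sub_le_of_norm_deriv_sub_le (convex_closedBall c r)
    (fun w hw => (hh w hw).differentiableAt) ha hz fun w hw => ?_
  refine (convex_closedBall c r).norm_image_sub_le_of_norm_deriv_le
    (fun v hv => (hh v hv).deriv.differentiableAt) (fun v hv => (hMh v hv).trans ?_) ha hw
  gcongr
  exact norm_deriv_le_of_norm_deriv_deriv_le hh hM hMh ha hv

theorem inner_mul_mul_right (u v w : ℂ) : ⟪u * w, v * w⟫_ℝ = ‖w‖ ^ 2 * ⟪u, v⟫_ℝ := by
  simp only [Complex.inner, map_mul, Complex.sq_norm, Complex.normSq_apply, Complex.mul_re,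
    Complex.mul_im, Complex.conj_re, Complex.conj_im]
  ring

theorem inner_mul_deriv_sub_neg (hh : AnalyticOnNhd ℂ h (closedBall c r)) (hM : 0 ≤ M)
    (hMh : ∀ z ∈ closedBall c r, ‖deriv (deriv h) z‖ ≤ M * ‖deriv h z‖) (hc : deriv h c ≠ 0)
    (hMr : M * r * Real.exp (2 * (M * r)) < 1) (ha : a ∈ closedBall c r)
    (hza : ‖z - c‖ ≤ ‖a - c‖) (hne : z ≠ a) : ⟪(a - c) * deriv h a, h z - h a⟫_ℝ < 0 := by
  have har : ‖a - c‖ ≤ r := mem_closedBall_iff_norm.1 ha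
  have hr : 0 ≤ r := (norm_nonneg _).trans har
  have hz : z ∈ closedBall c r := mem_closedBall_iff_norm.2 (hza.trans har)
  have hpos : 0 < ‖deriv h a‖ ^ 2 * ‖z - a‖ ^ 2 := by
    have := deriv_ne_zero_of_norm_deriv_deriv_le hh hM hMh hc ha
    have := sub_ne_zero.2 hne
    positivity
  have hlinear : ⟪(a - c) * deriv h a, (z - a) * deriv h a⟫_ℝ ≤
      -(‖deriv h a‖ ^ 2 * ‖z - a‖ ^ 2 / 2) := by
    have hexpand := norm_add_sq_real (a - c) (z - a)
    rw [add_comm, sub_add_sub_cancel] at hexpand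
    rw [inner_mul_mul_right]
    nlinarith [pow_le_pow_left₀ (norm_nonneg _) hza 2, sq_nonneg ‖deriv h a‖]
  have hremainder : ⟪(a - c) * deriv h a, h z - h a - (z - a) * deriv h a⟫_ℝ ≤
      M * r * Real.exp (2 * (M * r)) * (‖deriv h a‖ ^ 2 * ‖z - a‖ ^ 2) / 2 := by
    calc _ ≤ ‖(a - c) * deriv h a‖ * ‖h z - h a - (z - a) * deriv h a‖ := real_inner_le_norm _ _
      _ ≤ r * ‖deriv h a‖ *
          (M * (‖deriv h a‖ * Real.exp (2 * (M * r))) / 2 * ‖z - a‖ ^ 2) := by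
        rw [norm_mul]
        gcongr
        exact norm_sub_sub_mul_deriv_le hh hM hMh ha hz
      _ = _ := by ring
  have hsplit : ⟪(a - c) * deriv h a, h z - h a⟫_ℝ = ⟪(a - c) * deriv h a, (z - a) * deriv h a⟫_ℝ +
      ⟪(a - c) * deriv h a, h z - h a - (z - a) * deriv h a⟫_ℝ := by
    rw [← inner_add_right, add_sub_cancel]
  nlinarith

theorem injOn_closedBall_of_norm_deriv_deriv_le (hh : AnalyticOnNhd ℂ h (closedBall c r))
    (hM : 0 ≤ M) (hMh : ∀ z ∈ closedBall c r, ‖deriv (deriv h) z‖ ≤ M * ‖deriv h z‖)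
    (hc : deriv h c ≠ 0) (hMr : M * r * Real.exp (2 * (M * r)) < 1) :
    InjOn h (closedBall c r) := by
  intro x hx y hy hxy
  by_contra hne
  wlog hle : ‖x - c‖ ≤ ‖y - c‖ generalizing x y
  · exact this hy hx hxy.symm (Ne.symm hne) (le_of_not_ge hle)
  have hneg := inner_mul_deriv_sub_neg hh hM hMh hc hMr hy hle hne
  rw [hxy, sub_self, inner_zero_right] at hneg
  exact hneg.false

theorem convex_image_ball_of_norm_deriv_deriv_le (hh : AnalyticOnNhd ℂ h (closedBall c r))
    (hM : 0 ≤ M) (hMh : ∀ z ∈ closedBall c r, ‖deriv (deriv h) z‖ ≤ M * ‖deriv h z‖)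
    (hc : deriv h c ≠ 0) (hMr : M * r * Real.exp (2 * (M * r)) < 1) :
    Convex ℝ (h '' ball c r) := by
  have hopen : IsOpen (h '' ball c r) := isOpen_image_of_deriv_ne_zero isOpen_ball
    (hh.differentiableOn.mono ball_subset_closedBall) fun z hz =>
      deriv_ne_zero_of_norm_deriv_deriv_le hh hM hMh hc (ball_subset_closedBall hz)
  have hclosure : closure (h '' ball c r) ⊆ h '' closedBall c r :=
    closure_minimal (image_mono ball_subset_closedBall)
      ((isCompact_closedBall c r).image_of_continuousOn hh.continuousOn).isClosed
  refine convex_of_forall_mem_frontier_exists_lt hopen fun p hp => ?_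
  rw [hopen.frontier_eq] at hp
  obtain ⟨a, ha, rfl⟩ := hclosure hp.1
  have hra : r ≤ ‖a - c‖ := by
    by_contra! hlt
    exact hp.2 (mem_image_of_mem h (mem_ball_iff_norm.2 hlt))
  refine ⟨innerSL ℝ ((a - c) * deriv h a), ?_⟩
  rintro _ ⟨z, hz, rfl⟩
  have hza : ‖z - c‖ < ‖a - c‖ := (mem_ball_iff_norm.1 hz).trans_le hra
  have hneg := inner_mul_deriv_sub_neg hh hM hMh hc hMr ha hza.le (by rintro rfl; exact hza.false)
  rwa [inner_sub_right, sub_neg] at hneg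

end ConvexImage

section SchwarzPick

/-- The automorphism `w ↦ (w + a) / (1 + ā w)` of the unit disk, which sends `0` to `a`. -/
noncomputable def diskShift (a w : ℂ) : ℂ := (w + a) / (1 + conj a * w)

variable {a w z : ℂ} {ω : ℂ → ℂ}

theorem one_add_conj_mul_ne_zero (ha : ‖a‖ < 1) (hw : ‖w‖ < 1) : 1 + conj a * w ≠ 0 := by
  intro h
  have hnorm : ‖a‖ * ‖w‖ = 1 := by
    rw [← Complex.norm_conj a, ← norm_mul, ← norm_neg, ← eq_neg_of_add_eq_zero_left h, norm_one]
  exact (mul_lt_one_of_nonneg_of_lt_one_left (norm_nonneg a) ha hw.le).ne hnorm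

theorem mapsTo_diskShift (ha : ‖a‖ < 1) : MapsTo (diskShift a) (ball 0 1) (ball 0 1) := by
  intro w hw
  rw [mem_ball_zero_iff] at hw ⊢
  rw [diskShift, norm_div, div_lt_one (norm_pos_iff.2 (one_add_conj_mul_ne_zero ha hw))]
  refine lt_of_pow_lt_pow_left₀ 2 (norm_nonneg _) ?_
  have hdiff : ‖1 + conj a * w‖ ^ 2 - ‖w + a‖ ^ 2 = (1 - ‖a‖ ^ 2) * (1 - ‖w‖ ^ 2) := by
    simp only [Complex.sq_norm, Complex.normSq_apply, Complex.add_re, Complex.add_im,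
      Complex.mul_re, Complex.mul_im, Complex.conj_re, Complex.conj_im, Complex.one_re,
      Complex.one_im]
    ring
  have hpos : 0 < (1 - ‖a‖ ^ 2) * (1 - ‖w‖ ^ 2) := by
    apply mul_pos <;> nlinarith [norm_nonneg a, norm_nonneg w]
  linarith

theorem hasDerivAt_diskShift (ha : ‖a‖ < 1) (hw : ‖w‖ < 1) :
    HasDerivAt (diskShift a) ((1 - ‖a‖ ^ 2) / (1 + conj a * w) ^ 2) w := by
  have hden : HasDerivAt (fun w : ℂ => 1 + conj a * w) (conj a) w := by
    simpa using ((hasDerivAt_id w).const_mul (conj a)).const_add 1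
  refine (((hasDerivAt_id w).add_const a).fun_div hden
    (one_add_conj_mul_ne_zero ha hw)).congr_deriv ?_
  rw [← Complex.conj_mul', id]
  ring

theorem diskShift_mem_classBs (ha : ‖a‖ < 1) : diskShift a ∈ ClassBs :=
  ⟨fun _ hw => (hasDerivAt_diskShift ha
    (mem_ball_zero_iff.1 hw)).differentiableAt.differentiableWithinAt, mapsTo_diskShift ha⟩

theorem comp_mem_classBs {φ : ℂ → ℂ} (hφ : φ ∈ ClassBs) (hω : ω ∈ ClassBs) : φ ∘ ω ∈ ClassBs :=
  ⟨hφ.1.comp hω.1 hω.2, hφ.2.comp hω.2⟩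

theorem norm_lt_one_of_mem_classBs (hω : ω ∈ ClassBs) (hz : ‖z‖ < 1) : ‖ω z‖ < 1 :=
  mem_ball_zero_iff.1 (hω.2 (mem_ball_zero_iff.2 hz))

theorem hasDerivAt_of_mem_classBs (hω : ω ∈ ClassBs) (hz : ‖z‖ < 1) :
    HasDerivAt ω (deriv ω z) z :=
  (hω.1.differentiableAt (isOpen_ball.mem_nhds (mem_ball_zero_iff.2 hz))).hasDerivAt

theorem norm_deriv_zero_le_of_mem_classBs (hω : ω ∈ ClassBs) : ‖deriv ω 0‖ ≤ 1 - ‖ω 0‖ ^ 2 := by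
  have h0 : ‖ω 0‖ < 1 := norm_lt_one_of_mem_classBs hω (by simp)
  have h0' : ‖-ω 0‖ < 1 := by rwa [norm_neg]
  have hpos : 0 < 1 - ‖ω 0‖ ^ 2 := by nlinarith [norm_nonneg (ω 0)]
  have hF := comp_mem_classBs (diskShift_mem_classBs h0') hω
  have hF0 : (diskShift (-ω 0) ∘ ω) 0 = 0 := by simp [diskShift]
  have hschwarz := Complex.norm_deriv_le_one_of_mapsTo_ball hF.1
    (by rw [hF0]; exact hF.2.mono_right ball_subset_closedBall) one_pos
  have hderiv := ((hasDerivAt_diskShift h0' h0).comp 0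
    (hasDerivAt_of_mem_classBs hω (by simp))).deriv
  have hfactor : (1 - ‖-ω 0‖ ^ 2) / (1 + conj (-ω 0) * ω 0) ^ 2 =
      (((1 - ‖ω 0‖ ^ 2)⁻¹ : ℝ) : ℂ) := by
    have hden : 1 + conj (-ω 0) * ω 0 = ((1 - ‖ω 0‖ ^ 2 : ℝ) : ℂ) := by
      rw [map_neg, neg_mul, Complex.conj_mul']
      push_cast
      ring
    rw [hden, norm_neg]
    norm_cast
    field_simp
  rwa [hderiv, hfactor, norm_mul, Complex.norm_real, Real.norm_of_nonneg (by positivity),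
    inv_mul_le_iff₀ hpos, mul_one] at hschwarz

theorem norm_deriv_mul_le_of_mem_classBs (hω : ω ∈ ClassBs) (hz : ‖z‖ < 1) :
    ‖deriv ω z‖ * (1 - ‖z‖ ^ 2) ≤ 1 - ‖ω z‖ ^ 2 := by
  have hshift : diskShift z 0 = z := by simp [diskShift]
  have hωz : HasDerivAt ω (deriv ω z) (diskShift z 0) := by
    rw [hshift]
    exact hasDerivAt_of_mem_classBs hω hz
  have hle := norm_deriv_zero_le_of_mem_classBs (comp_mem_classBs hω (diskShift_mem_classBs hz))
  have hpos : 0 ≤ 1 - ‖z‖ ^ 2 := by nlinarith [norm_nonneg z]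
  have hfactor : (1 - ‖z‖ ^ 2) / (1 + conj z * 0) ^ 2 = ((1 - ‖z‖ ^ 2 : ℝ) : ℂ) := by simp
  rwa [(hωz.comp 0 (hasDerivAt_diskShift hz (by simp))).deriv, hfactor, norm_mul,
    Complex.norm_real, Real.norm_of_nonneg hpos, Function.comp_apply, hshift] at hle

end SchwarzPick

section Lemniscate

variable {h ω : ℂ → ℂ} {u z : ℂ}

theorem one_sub_norm_le_re_one_add (u : ℂ) : 1 - ‖u‖ ≤ (1 + u).re := by
  rw [Complex.add_re, Complex.one_re]
  linarith [neg_le_of_abs_le (Complex.abs_re_le_norm u)]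

theorem one_add_mem_slitPlane (hu : ‖u‖ < 1) : 1 + u ∈ Complex.slitPlane :=
  Or.inl ((sub_pos.2 hu).trans_le (one_sub_norm_le_re_one_add u))

theorem sq_complex_sqrt (u : ℂ) : Complex.sqrt u ^ 2 = u :=
  Complex.cpow_ofNat_inv_pow u 2

theorem sqrt_re_le_re_sqrt (u : ℂ) : √u.re ≤ (Complex.sqrt u).re := by
  rw [Complex.sqrt, Complex.cpow_inv_two_re]
  exact Real.sqrt_le_sqrt (by linarith [Complex.re_le_norm u])

theorem norm_sqrt_one_add_sub_one_le (u : ℂ) :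
    ‖Complex.sqrt (1 + u) - 1‖ ≤ ‖u‖ / (1 + √(1 - ‖u‖)) := by
  have hprod : ‖Complex.sqrt (1 + u) - 1‖ * ‖Complex.sqrt (1 + u) + 1‖ = ‖u‖ := by
    rw [← norm_mul]
    congr 1
    linear_combination sq_complex_sqrt (1 + u)
  have hre : 1 + √(1 - ‖u‖) ≤ ‖Complex.sqrt (1 + u) + 1‖ :=
    calc 1 + √(1 - ‖u‖) ≤ 1 + √(1 + u).re := by gcongr; exact one_sub_norm_le_re_one_add u
      _ ≤ (Complex.sqrt (1 + u) + 1).re := by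
        rw [Complex.add_re (Complex.sqrt _), Complex.one_re]
        linarith [sqrt_re_le_re_sqrt (1 + u)]
      _ ≤ _ := Complex.re_le_norm _
  rw [le_div_iff₀ (by positivity)]
  exact (mul_le_mul_of_nonneg_left hre (norm_nonneg _)).trans_eq hprod

theorem exists_mul_deriv_eq_sqrt_mul (hh : h ∈ ClassSLStar) :
    ∃ ω ∈ ClassBs, ω 0 = 0 ∧
      ∀ z ∈ ball (0 : ℂ) 1, z * deriv h z = Complex.sqrt (1 + ω z) * h z := by
  obtain ⟨⟨-, h0, -⟩, ω, hω, hω0, hsub⟩ := hh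
  refine ⟨ω, hω, hω0, fun z hz => ?_⟩
  rcases eq_or_ne z 0 with rfl | hz0
  · rw [zero_mul, h0, mul_zero]
  have hquot : z * deriv h z / h z = Complex.sqrt (1 + ω z) := by
    have hsubz := hsub z hz
    rwa [starlikeQuotient, Function.update_of_ne hz0, one_div] at hsubz
  have hωz : ‖ω z‖ < 1 := norm_lt_one_of_mem_classBs hω (mem_ball_zero_iff.1 hz)
  have hhz : h z ≠ 0 := by
    -- If `h z = 0`, the junk value `0` of the quotient would be a square root of `1 + ω z`.
    intro hz'
    rw [hz', div_zero] at hquot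
    refine Complex.slitPlane_ne_zero (one_add_mem_slitPlane hωz) ?_
    rw [← sq_complex_sqrt (1 + ω z), ← hquot, zero_pow two_ne_zero]
  exact (div_eq_iff hhz).1 hquot

theorem hasDerivAt_sqrt_one_add (hω : HasDerivAt ω u z) (hωz : ‖ω z‖ < 1) :
    HasDerivAt (fun w => Complex.sqrt (1 + ω w)) (u / (2 * Complex.sqrt (1 + ω z))) z := by
  have hsqrt := (Complex.hasDerivAt_sqrt (one_add_mem_slitPlane hωz)).comp z (hω.const_add 1)
  refine hsqrt.congr_deriv ?_
  rw [neg_div, Complex.cpow_neg, one_div, ← Complex.sqrt]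
  ring

theorem deriv_deriv_eq_of_mul_deriv_eq_sqrt_mul (hh : DifferentiableOn ℂ h (ball 0 1))
    (hω : ω ∈ ClassBs)
    (heq : ∀ z ∈ ball (0 : ℂ) 1, z * deriv h z = Complex.sqrt (1 + ω z) * h z)
    (hz : ‖z‖ < 1) (hz0 : z ≠ 0) :
    deriv (deriv h) z =
      (deriv ω z / (2 * (1 + ω z)) + (Complex.sqrt (1 + ω z) - 1) / z) * deriv h z := by
  have hzball : z ∈ ball (0 : ℂ) 1 := mem_ball_zero_iff.2 hz
  have hnhds : ball (0 : ℂ) 1 ∈ 𝓝 z := isOpen_ball.mem_nhds hzball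
  have hωz := norm_lt_one_of_mem_classBs hω hz
  have hsqrt0 : Complex.sqrt (1 + ω z) ≠ 0 := fun h0 =>
    Complex.slitPlane_ne_zero (one_add_mem_slitPlane hωz) <| by
      rw [← sq_complex_sqrt (1 + ω z), h0, zero_pow two_ne_zero]
  have hleft := (hasDerivAt_id z).fun_mul
    ((hh.deriv isOpen_ball).differentiableAt hnhds).hasDerivAt
  have hright := (hasDerivAt_sqrt_one_add (hasDerivAt_of_mem_classBs hω hz) hωz).fun_mul
    (hh.differentiableAt hnhds).hasDerivAt
  have hderiv := hleft.unique
    (hright.congr_of_eventuallyEq (Filter.eventually_of_mem hnhds heq))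
  have hz' := heq z hzball
  have hsq := sq_complex_sqrt (1 + ω z)
  generalize Complex.sqrt (1 + ω z) = s at *
  rw [← hsq]
  simp only [id] at hderiv
  field_simp at hderiv ⊢
  linear_combination s * hderiv - deriv ω z * hz'

theorem norm_le_norm_of_mem_classBs (hω : ω ∈ ClassBs) (hω0 : ω 0 = 0) (hz : ‖z‖ < 1) :
    ‖ω z‖ ≤ ‖z‖ :=
  Complex.norm_le_norm_of_mapsTo_ball hω.1 (hω.2.mono_right ball_subset_closedBall) hω0 hz

theorem norm_deriv_div_one_add_le (hω : ω ∈ ClassBs) (hω0 : ω 0 = 0) (hz : ‖z‖ < 1) :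
    ‖deriv ω z / (2 * (1 + ω z))‖ ≤ 1 / (2 * (1 - ‖z‖)) := by
  have hωz := norm_le_norm_of_mem_classBs hω hω0 hz
  have hden : 1 - ‖ω z‖ ≤ ‖1 + ω z‖ :=
    (one_sub_norm_le_re_one_add (ω z)).trans (Complex.re_le_norm _)
  have hpick : ‖deriv ω z‖ * (1 - ‖z‖) ≤ 1 - ‖ω z‖ := by
    have hprod := norm_deriv_mul_le_of_mem_classBs hω hz
    refine le_of_mul_le_mul_right ?_ (by positivity : 0 < 1 + ‖z‖)
    calc ‖deriv ω z‖ * (1 - ‖z‖) * (1 + ‖z‖) = ‖deriv ω z‖ * (1 - ‖z‖ ^ 2) := by ring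
      _ ≤ (1 - ‖ω z‖) * (1 + ‖ω z‖) := by linarith
      _ ≤ (1 - ‖ω z‖) * (1 + ‖z‖) := by gcongr; linarith
  rw [norm_div, norm_mul, Complex.norm_two, div_le_div_iff₀ (by linarith) (by linarith)]
  linarith

theorem norm_sqrt_one_add_sub_one_div_le (hω : ω ∈ ClassBs) (hω0 : ω 0 = 0) (hz : ‖z‖ < 1) :
    ‖(Complex.sqrt (1 + ω z) - 1) / z‖ ≤ 1 / (1 + √(1 - ‖z‖)) := by
  have hωz := norm_le_norm_of_mem_classBs hω hω0 hz
  rw [norm_div]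
  refine div_le_of_le_mul₀ (norm_nonneg z) (by positivity) ?_
  calc ‖Complex.sqrt (1 + ω z) - 1‖ ≤ ‖ω z‖ / (1 + √(1 - ‖ω z‖)) :=
        norm_sqrt_one_add_sub_one_le _
    _ ≤ ‖z‖ / (1 + √(1 - ‖z‖)) := by gcongr
    _ = 1 / (1 + √(1 - ‖z‖)) * ‖z‖ := by ring

theorem norm_deriv_deriv_le_of_mem_classSLStar (hh : h ∈ ClassSLStar) (hz : ‖z‖ < 1) :
    ‖deriv (deriv h) z‖ ≤ (1 / (2 * (1 - ‖z‖)) + 1 / (1 + √(1 - ‖z‖))) * ‖deriv h z‖ := by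
  obtain ⟨ω, hω, hω0, heq⟩ := exists_mul_deriv_eq_sqrt_mul hh
  have hne : ∀ w ∈ ball (0 : ℂ) 1, w ≠ 0 → ‖deriv (deriv h) w‖ ≤
      (1 / (2 * (1 - ‖w‖)) + 1 / (1 + √(1 - ‖w‖))) * ‖deriv h w‖ := by
    intro w hw hw0
    rw [mem_ball_zero_iff] at hw
    rw [deriv_deriv_eq_of_mul_deriv_eq_sqrt_mul hh.1.1 hω heq hw hw0, norm_mul]
    gcongr
    exact norm_add_le_of_le (norm_deriv_div_one_add_le hω hω0 hw)
      (norm_sqrt_one_add_sub_one_div_le hω hω0 hw)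
  rcases eq_or_ne z 0 with rfl | hz0
  · have hball : ball (0 : ℂ) 1 ∈ 𝓝 (0 : ℂ) := ball_mem_nhds _ one_pos
    have hh' := hh.1.1.deriv isOpen_ball
    have hcont' := (hh'.differentiableAt hball).continuousAt
    have hcont'' := ((hh'.deriv isOpen_ball).differentiableAt hball).continuousAt
    have hbound : ContinuousAt (fun w : ℂ =>
        (1 / (2 * (1 - ‖w‖)) + 1 / (1 + √(1 - ‖w‖))) * ‖deriv h w‖) 0 := by
      refine ContinuousAt.mul (ContinuousAt.add ?_ ?_) hcont'.norm
      · exact ContinuousAt.div (by fun_prop) (by fun_prop) (by norm_num)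
      · exact ContinuousAt.div (by fun_prop) (by fun_prop) (by norm_num)
    refine le_of_tendsto_of_tendsto (b := 𝓝[≠] 0) (hcont''.norm.mono_left nhdsWithin_le_nhds)
      (hbound.mono_left nhdsWithin_le_nhds) ?_
    filter_upwards [self_mem_nhdsWithin, nhdsWithin_le_nhds hball] with w hw0 hw
    exact hne w hw hw0
  · exact hne z (mem_ball_zero_iff.2 hz) hz0

end Lemniscate

section Radius

variable {h : ℂ → ℂ} {z : ℂ} {r s : ℝ}

theorem norm_deriv_deriv_le_mul_of_norm_le (hh : h ∈ ClassSLStar) (hz : ‖z‖ ≤ 0.312) :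
    ‖deriv (deriv h) z‖ ≤ 1.3 * ‖deriv h z‖ := by
  refine (norm_deriv_deriv_le_of_mem_classSLStar hh (hz.trans_lt (by norm_num))).trans ?_
  have hsqrt : 0.82 ≤ √(1 - ‖z‖) := Real.le_sqrt_of_sq_le (by norm_num1 at hz ⊢; linarith)
  gcongr
  calc 1 / (2 * (1 - ‖z‖)) + 1 / (1 + √(1 - ‖z‖))
      ≤ 1 / (2 * (1 - 0.312)) + 1 / (1 + 0.82) := by gcongr
    _ ≤ 1.3 := by norm_num

theorem mul_exp_two_mul_lt_one (hs : s ≤ 0.4056) : s * Real.exp (2 * s) < 1 := by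
  -- `0.1014 = 2 * 0.4056 / 8` is small enough for the bound `exp x ≤ 1 / (1 - x)` to suffice.
  have hexp : Real.exp 0.1014 ≤ 1 / (1 - 0.1014) := Real.exp_bound_div_one_sub_of_interval
    (by norm_num) (by norm_num)
  calc s * Real.exp (2 * s) ≤ 0.4056 * Real.exp (2 * 0.4056) := by gcongr
    _ = 0.4056 * Real.exp 0.1014 ^ 8 := by rw [← Real.exp_nat_mul]; norm_num
    _ ≤ 0.4056 * (1 / (1 - 0.1014)) ^ 8 := by gcongr
    _ < 1 := by norm_num

theorem exists_forall_norm_le_of_mem_classBs {φ : ℂ → ℂ} (hφ : φ ∈ ClassBs) (hr : r < 1) :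
    ∃ k : ℝ≥0, k < 1 ∧ ∀ z ∈ closedBall (0 : ℂ) r, ‖φ z‖ ≤ k := by
  have hsub : closedBall (0 : ℂ) r ⊆ ball 0 1 := closedBall_subset_ball hr
  rcases (closedBall (0 : ℂ) r).eq_empty_or_nonempty with hempty | hne
  · exact ⟨0, one_pos, by simp [hempty]⟩
  obtain ⟨m, hm, hmax⟩ := (isCompact_closedBall (0 : ℂ) r).exists_isMaxOn hne
    (hφ.1.continuousOn.mono hsub).norm
  exact ⟨‖φ m‖₊, norm_lt_one_of_mem_classBs hφ (mem_ball_zero_iff.1 (hsub hm)),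
    isMaxOn_iff.1 hmax⟩

theorem isCloseToConvexOn_add_conj_of_mem_classSLStar {g φ : ℂ → ℂ} (hh : h ∈ ClassSLStar)
    (hφ : φ ∈ ClassBs) (hg : DifferentiableOn ℂ g (ball 0 1))
    (hgφ : ∀ z ∈ ball (0 : ℂ) 1, deriv g z = φ z * deriv h z) (hr : 0 < r) (hr' : r ≤ 0.312) :
    IsCloseToConvexOn (fun z => h z + conj (g z)) (ball 0 r) := by
  have hr1 : r < 1 := hr'.trans_lt (by norm_num)
  have hsub : closedBall (0 : ℂ) r ⊆ ball 0 1 := closedBall_subset_ball hr1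
  have hsub' : ball (0 : ℂ) r ⊆ ball 0 1 := ball_subset_ball hr1.le
  have hhr : AnalyticOnNhd ℂ h (closedBall 0 r) := (hh.1.1.analyticOnNhd isOpen_ball).mono hsub
  have hM : (0 : ℝ) ≤ 1.3 := by norm_num
  have hMh : ∀ z ∈ closedBall (0 : ℂ) r, ‖deriv (deriv h) z‖ ≤ 1.3 * ‖deriv h z‖ := fun z hz =>
    norm_deriv_deriv_le_mul_of_norm_le hh ((mem_closedBall_zero_iff.1 hz).trans hr')
  have hc : deriv h 0 ≠ 0 := hh.1.2.2 ▸ one_ne_zero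
  have hMr : 1.3 * r * Real.exp (2 * (1.3 * r)) < 1 := mul_exp_two_mul_lt_one (by linarith)
  obtain ⟨k, hk, hφk⟩ := exists_forall_norm_le_of_mem_classBs hφ hr1
  refine isCloseToConvexOn_add_conj isOpen_ball (nonempty_ball.2 hr) (hh.1.1.mono hsub')
    ((injOn_closedBall_of_norm_deriv_deriv_le hhr hM hMh hc hMr).mono ball_subset_closedBall)
    (fun z hz => deriv_ne_zero_of_norm_deriv_deriv_le hhr hM hMh hc (ball_subset_closedBall hz))
    (convex_image_ball_of_norm_deriv_deriv_le hhr hM hMh hc hMr) (hg.mono hsub') hk fun z hz => ?_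
  rw [hgφ z (hsub' hz), norm_mul]
  gcongr
  exact hφk z (ball_subset_closedBall hz)

theorem quartic_eq_sub_one_mul_cubic (r : ℝ) : 1 - 6 * r + 12 * r ^ 2 - 11 * r ^ 3 + 4 * r ^ 4 =
    (r - 1) * (4 * r ^ 3 - 7 * r ^ 2 + 5 * r - 1) := by
  ring

theorem strictMono_cubic : StrictMono fun r : ℝ => 4 * r ^ 3 - 7 * r ^ 2 + 5 * r - 1 := by
  intro x y hxy
  have hslope : 0 < 4 * (x ^ 2 + x * y + y ^ 2) - 7 * (x + y) + 5 := by
    nlinarith [sq_nonneg (x - y), sq_nonneg (x + y - 7 / 6)]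
  have hdiff := mul_pos (sub_pos.2 hxy) hslope
  dsimp only
  linarith

theorem exists_cubic_eq_zero :
    ∃ r ∈ Ioo (0.3119 : ℝ) 0.3120, 4 * r ^ 3 - 7 * r ^ 2 + 5 * r - 1 = 0 :=
  intermediate_value_Ioo (f := fun r : ℝ => 4 * r ^ 3 - 7 * r ^ 2 + 5 * r - 1) (by norm_num)
    (by fun_prop) ⟨by norm_num, by norm_num⟩

theorem cubic_eq_zero_of_quartic_eq_zero (hr : r ≠ 1)
    (hroot : 1 - 6 * r + 12 * r ^ 2 - 11 * r ^ 3 + 4 * r ^ 4 = 0) :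
    4 * r ^ 3 - 7 * r ^ 2 + 5 * r - 1 = 0 := by
  rw [quartic_eq_sub_one_mul_cubic] at hroot
  exact (mul_eq_zero.1 hroot).resolve_left (sub_ne_zero.2 hr)

end Radius

theorem mainTheorem8 :
    ∃ r₀ : ℝ, r₀ ∈ Ioo (0 : ℝ) 1 ∧
      1 - 6 * r₀ + 12 * r₀ ^ 2 - 11 * r₀ ^ 3 + 4 * r₀ ^ 4 = 0 ∧
      (∀ r ∈ Ioo (0 : ℝ) 1, 1 - 6 * r + 12 * r ^ 2 - 11 * r ^ 3 + 4 * r ^ 4 = 0 → r = r₀) ∧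
      r₀ ∈ Ioo (0.3119 : ℝ) 0.3120 ∧
      ∀ h g φ : ℂ → ℂ, h ∈ ClassSLStar → φ ∈ ClassBs →
        DifferentiableOn ℂ g (ball 0 1) →
        (∀ z ∈ ball (0 : ℂ) 1, deriv g z = φ z * deriv h z) →
        IsUnivalentOn (fun z => h z + conj (g z)) (ball 0 r₀) ∧
          IsCloseToConvexOn (fun z => h z + conj (g z)) (ball 0 r₀) := by
  obtain ⟨r₀, hr₀, hcubic⟩ := exists_cubic_eq_zero
  have hpos : 0 < r₀ := lt_trans (by norm_num) hr₀.1
  have hle : r₀ ≤ 0.312 := hr₀.2.le.trans_eq (by norm_num)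
  have hroot : 1 - 6 * r₀ + 12 * r₀ ^ 2 - 11 * r₀ ^ 3 + 4 * r₀ ^ 4 = 0 := by
    rw [quartic_eq_sub_one_mul_cubic, hcubic, mul_zero]
  refine ⟨r₀, ⟨hpos, hle.trans_lt (by norm_num)⟩, hroot, fun r hr hr0 => ?_, hr₀,
    fun h g φ hh hφ hg hgφ => ?_⟩
  · exact strictMono_cubic.injective
      ((cubic_eq_zero_of_quartic_eq_zero hr.2.ne hr0).trans hcubic.symm)
  · have hctc := isCloseToConvexOn_add_conj_of_mem_classSLStar hh hφ hg hgφ hpos hle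
    exact ⟨hctc.2.1, hctc⟩
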